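/- Let $M$ be a simple structural causal model (SCM): it has finitely many endogenous variables and finitely many jointly independent exogenous (unobserved) variables, all with standard Borel values; each endogenous variable is a measurable function (its mechanism) of its endogenous and exogenous parents; and for every set $O$ of endogenous variables the structural equations of $O$ have, for almost every value of the exogenous variables and all values of the endogenous variables outside $O$, a unique solution, given by a measurable function of the parents of $O$. Let $G$ be its directed mixed graph on the endogenous variables, possibly cyclic: for different $A,B$, $A\to B$ if $A$ is a parent of $B$, and $A\leftrightarrow B$ if $A$ and $B$ share an exogenous parent (latent confounding). Ancestors are along (possibly trivial) directed paths. A path between $A$ and $B$ is $\sigma$-blocked by a set $C$ if an end node is in $C$, or it contains a collider that is not an ancestor of an element of $C$, or it contains a non-collider in $C$ that points to a neighbouring node on the path in another strongly connected component of $G$; sets $\boldsymbol A,\boldsymbol B$ are $\sigma$-separated by $C$ if all paths between them are $\sigma$-blocked by $C$. Assume that $M$ is $\sigma$-faithful: for disjoint sets of endogenous variables, every conditional independence $\boldsymbol A\perp\!\!\!\perp\boldsymbol B\mid \boldsymbol C$ in the observational distribution (the law of a solution of $M$) implies that $\boldsymbol A$ and $\boldsymbol B$ are $\sigma$-separated by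 $\boldsymbol C$ in $G$. Let $V,W,X,Y$ be distinct endogenous variables and $\boldsymbol S$ a set of endogenous (selection) variables not containing any of them. Suppose that, in the observational distribution, $$V\perp\!\!\!\perp Y\mid \{X\}\cup\boldsymbol S,\quad V\not\perp\!\!\!\perp Y\mid \boldsymbol S,\quad V\not\perp\!\!\!\perp W\mid \{X\}\cup\boldsymbol S,\quad V\perp\!\!\!\perp W\mid \boldsymbol S,$$ that is, $V\perp\!\!\!\perp Y\mid [X]\cup\boldsymbol S$ and $V\not\perp\!\!\!\perp W\mid [X]\cup\boldsymbol S$ hold minimally. Then $X$ is an ancestor of $Y$; $Y$ is not an ancestor of $X$; $X$ is not an ancestor of any element of $\boldsymbol S$; and $X$ and $Y$ are unconfounded: there is no edge $X\leftrightarrow Y$ in $G$, nor in the latent projection of $G$ onto $\boldsymbol S\cup\{X,Y\}$, i.e. $G$ has no walk between $X$ and $Y$ with arrowheads at both end nodes, without colliders, and with all interior nodes outside $\boldsymbol S\cup\{X,Y\}$. -/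

import Mathlib

open MeasureTheory ProbabilityTheory

/-! ## Directed mixed graphs and sigma-separation -/

/-- A directed mixed graph with node set `N`: directed edges `u → v` and bidirected edges `u ↔ v`
between pairs of different nodes. Directed cycles are allowed, and several edges of different types
may connect the same pair of nodes. -/
structure DMG (N : Type*) where
  dir : N → N → Prop
  bi : N → N → Prop
  dir_ne : ∀ u v, dir u v → u ≠ v
  bi_ne : ∀ u v, bi u v → u ≠ v
  bi_symm : ∀ u v, bi u v → bi v u

/-- The three ways in which an edge can be traversed from a node `u` to a node `v`:
`u → v`, `u ← v` and `u ↔ v`. -/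
inductive EdgeKind
  | fwd
  | bwd
  | bidir

namespace EdgeKind

/-- The edge has an arrowhead at the node that the traversal leaves (`u ← v` or `u ↔ v`). -/
def HeadAtSource : EdgeKind → Prop
  | fwd => False
  | bwd => True
  | bidir => True

/-- The edge has an arrowhead at the node that the traversal enters (`u → v` or `u ↔ v`). -/
def HeadAtTarget : EdgeKind → Prop
  | fwd => True
  | bwd => False
  | bidir => True

end EdgeKind

namespace DMG

variable {N : Type*} (G : DMG N)

/-- The graph has an edge of the given kind from `u` to `v`. -/
def HasEdge : EdgeKind → N → N → Prop
  | EdgeKind.fwd, u, v => G.dir u v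
  | EdgeKind.bwd, u, v => G.dir v u
  | EdgeKind.bidir, u, v => G.bi u v

/-- `u` is an ancestor of `v`: there is a (possibly trivial) directed path from `u` to `v`. -/
def Anc (u v : N) : Prop := Relation.ReflTransGen G.dir u v

/-- `u` is an ancestor of some element of `C`. -/
def AncSet (u : N) (C : Set N) : Prop := ∃ c ∈ C, G.Anc u c

/-- `u` and `v` lie in the same strongly connected component. -/
def SameSCC (u v : N) : Prop := G.Anc u v ∧ G.Anc v u

/-- A walk from `a` to `b`: nodes `node 0 = a, …, node length = b`, where `edge i` connects
`node i` to `node (i + 1)`. Values at later indices are irrelevant. -/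
structure Walk (a b : N) where
  length : ℕ
  node : ℕ → N
  edge : ℕ → EdgeKind
  node_zero : node 0 = a
  node_length : node length = b
  hasEdge : ∀ i < length, G.HasEdge (edge i) (node i) (node (i + 1))

namespace Walk

variable {G} {a b : N} (w : G.Walk a b)

/-- A path is a walk on which every node occurs at most once. -/
def IsPath : Prop :=
  ∀ i j, i ≤ w.length → j ≤ w.length → w.node i = w.node j → i = j

/-- For `i + 1 < w.length`: the interior node `w.node (i + 1)` is a collider on the walk. -/
def ColliderAt (i : ℕ) : Prop :=
  (w.edge i).HeadAtTarget ∧ (w.edge (i + 1)).HeadAtSource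

/-- For `i + 1 < w.length`: the interior node `w.node (i + 1)` points to a neighbouring node on the
walk that lies in another strongly connected component. -/
def PointsOutAt (i : ℕ) : Prop :=
  (w.edge i = EdgeKind.bwd ∧ ¬ G.SameSCC (w.node (i + 1)) (w.node i)) ∨
  (w.edge (i + 1) = EdgeKind.fwd ∧ ¬ G.SameSCC (w.node (i + 1)) (w.node (i + 2)))

/-- The walk is sigma-blocked by `C`: an end node is in `C`, or there is a collider that is not an
ancestor of `C`, or there is a non-collider in `C` that points to a neighbouring node on the walk in
another strongly connected component. -/
def SigmaBlocked (C : Set N) : Prop :=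
  a ∈ C ∨ b ∈ C ∨
  (∃ i, i + 1 < w.length ∧ w.ColliderAt i ∧ ¬ G.AncSet (w.node (i + 1)) C) ∨
  (∃ i, i + 1 < w.length ∧ ¬ w.ColliderAt i ∧ w.node (i + 1) ∈ C ∧ w.PointsOutAt i)

/-- The walk represents latent confounding of its end nodes once the nodes outside `O` are
marginalized out: it is nontrivial, has arrowheads at both end nodes, has no collider, and all its
interior nodes lie outside `O`. -/
def IsConfounding (O : Set N) : Prop :=
  0 < w.length ∧ (w.edge 0).HeadAtSource ∧ (w.edge (w.length - 1)).HeadAtTarget ∧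
  ∀ i, i + 1 < w.length → ¬ w.ColliderAt i ∧ w.node (i + 1) ∉ O

end Walk

/-- `A` and `B` are sigma-separated by `C`: every path between a node of `A` and a node of `B` is
sigma-blocked by `C`. -/
def SigmaSep (A B C : Set N) : Prop :=
  ∀ a ∈ A, ∀ b ∈ B, ∀ w : G.Walk a b, w.IsPath → w.SigmaBlocked C

/-- The latent projection of `G` onto `O` (which is to contain `u` and `v`) has a bidirected edge
`u ↔ v`. A bidirected edge `u ↔ v` of `G` itself is an instance of this. -/
def Confounded (O : Set N) (u v : N) : Prop :=
  ∃ w : G.Walk u v, w.IsConfounding O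

end DMG

/-! ## Structural causal models -/

/-- A structural causal model with endogenous variables indexed by `I` (values in `X i`) and
exogenous, unobserved variables indexed by `J` (values in `E j`). `pa k i` and `exoPa j i` say that
the endogenous variable `k`, respectively the exogenous variable `j`, is a parent of `i`; the causal
mechanism `mech i` is a measurable function of the parents of `i`, and the exogenous variables are
independent with marginal laws `noise j`. -/
structure SCM (I J : Type*) (X : I → Type*) (E : J → Type*)
    [∀ i, MeasurableSpace (X i)] [∀ j, MeasurableSpace (E j)] where
  pa : I → I → Prop
  exoPa : J → I → Prop
  mech : ∀ i, (∀ k : {k // pa k i}, X k.1) × (∀ j : {j // exoPa j i}, E j.1) → X i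
  measurable_mech : ∀ i, Measurable (mech i)
  noise : ∀ j, Measure (E j)
  isProbabilityMeasure_noise : ∀ j, IsProbabilityMeasure (noise j)

namespace SCM

variable {I J : Type*} {X : I → Type*} {E : J → Type*}
  [∀ i, MeasurableSpace (X i)] [∀ j, MeasurableSpace (E j)]

/-- The right-hand side of the `i`-th structural equation at `(x, e)`. -/
def rhs (M : SCM I J X E) (x : ∀ i, X i) (e : ∀ j, E j) (i : I) : X i :=
  M.mech i (fun k => x k.1, fun j => e j.1)

/-- The joint (product) law of the exogenous variables. -/
noncomputable def noiseLaw [Fintype J] (M : SCM I J X E) : Measure (∀ j, E j) :=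
  haveI := M.isProbabilityMeasure_noise
  Measure.pi M.noise

/-- The directed mixed graph of the model: `u → v` if `u` is a parent of `v`, and `u ↔ v` if `u` and
`v` share an exogenous parent, for different endogenous `u` and `v`. -/
def graph (M : SCM I J X E) : DMG I where
  dir u v := u ≠ v ∧ M.pa u v
  bi u v := u ≠ v ∧ ∃ j, M.exoPa j u ∧ M.exoPa j v
  dir_ne _ _ h := h.1
  bi_ne _ _ h := h.1
  bi_symm _ _ h := ⟨h.1.symm, h.2.imp fun _ hj => ⟨hj.2, hj.1⟩⟩

/-- Unique solvability with respect to `O`: a measurable function of the parents of `O` outside `O`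
and of the exogenous parents of `O` gives, for almost every value of the exogenous variables, and for
all values of the endogenous ones, exactly the solutions of the structural equations of `O`. -/
def UniquelySolvable [Fintype J] (M : SCM I J X E) (O : Set I) : Prop :=
  ∃ g : (∀ k : {k // k ∉ O ∧ ∃ i ∈ O, M.pa k i}, X k.1) ×
      (∀ j : {j // ∃ i ∈ O, M.exoPa j i}, E j.1) → ∀ i : O, X i.1,
    Measurable g ∧
    ∀ᵐ e ∂M.noiseLaw, ∀ x : ∀ i, X i,
      (∀ i : O, x i.1 = g (fun k => x k.1, fun j => e j.1) i) ↔
      (∀ i : O, x i.1 = M.rhs x e i.1)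

/-- A simple model is uniquely solvable with respect to every set of endogenous variables. -/
def IsSimple [Fintype J] (M : SCM I J X E) : Prop := ∀ O : Set I, M.UniquelySolvable O

/-- Random variables `x` on a probability space `(Ω, μ)` form a solution of the model: for some
exogenous random variables `e` with the prescribed joint law the structural equations hold almost
surely. The law of `x` is then the observational distribution of the model. -/
def IsSolution [Fintype J] (M : SCM I J X E) {Ω : Type*} [MeasurableSpace Ω] (μ : Measure Ω)
    (x : ∀ i, Ω → X i) : Prop :=
  ∃ e : Ω → ∀ j, E j, Measurable e ∧ μ.map e = M.noiseLaw ∧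
    ∀ᵐ ω ∂μ, ∀ i, x i ω = M.rhs (fun k => x k ω) (e ω) i

end SCM

/-! ## Conditional independence of random variables -/

section CondIndependence

variable {I : Type*} {X : I → Type*} [∀ i, MeasurableSpace (X i)]
  {Ω : Type*} [mΩ : MeasurableSpace Ω]

/-- The sigma-algebra generated by the random variables `x i`, `i ∈ A`. -/
abbrev sigmaOf (x : ∀ i, Ω → X i) (A : Set I) : MeasurableSpace Ω :=
  ⨆ i ∈ A, MeasurableSpace.comap (x i) inferInstance

theorem sigmaOf_le {x : ∀ i, Ω → X i} (hx : ∀ i, Measurable (x i)) (A : Set I) :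
    sigmaOf x A ≤ mΩ :=
  iSup₂_le fun i _ => (hx i).comap_le

variable [StandardBorelSpace Ω] (μ : Measure Ω) [IsProbabilityMeasure μ]
  {x : ∀ i, Ω → X i} (hx : ∀ i, Measurable (x i))

/-- `(x i)_{i ∈ A}` and `(x i)_{i ∈ B}` are conditionally independent given `(x i)_{i ∈ C}`. -/
def CI (A B C : Set I) : Prop :=
  CondIndep (sigmaOf x C) (sigmaOf x A) (sigmaOf x B) (sigmaOf_le hx C) μ

/-- Minimal conditional independence `a ⫫ b | D ∪ [Z]`. -/
def MinIndep (a b : I) (D Z : Set I) : Prop :=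
  CI μ hx {a} {b} (D ∪ Z) ∧ ∀ Z' : Set I, Z' ⊂ Z → ¬ CI μ hx {a} {b} (D ∪ Z')

/-- Minimal conditional dependence of `a` and `b` given `D ∪ [Z]`. -/
def MinDep (a b : I) (D Z : Set I) : Prop :=
  ¬ CI μ hx {a} {b} (D ∪ Z) ∧ ∀ Z' : Set I, Z' ⊂ Z → CI μ hx {a} {b} (D ∪ Z')

/-- Sigma-faithfulness of the joint law of the random variables `x` to the graph `G`: conditional
independences between disjoint sets of variables are explained by sigma-separations. -/
def SigmaFaithful (G : DMG I) : Prop :=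
  ∀ A B C : Set I, Disjoint A B → Disjoint A C → Disjoint B C →
    CI μ hx A B C → G.SigmaSep A B C

end CondIndependence

/-! ### Open walks and their reduction to paths -/

namespace DMG

variable {N : Type*} {G : DMG N}

/-! Both separation and independence are compared with connectedness `Conn` in a moral graph on the
ancestors of `{a, b} ∪ C`. A node there represents the structural equations of its strongly
connected component: equations are linked within a component, through a shared exogenous parent, or
through a directed edge whose tail is not in `C`. A conditioned node can therefore be reached, but
does not transmit along edges leaving its component.

Two implications suffice. A connection yields an open path, so faithfulness turns independence into
disconnection (`SigmaSep.not_conn`). Disconnection implies independence by the global Markov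
property (`SCM.ci_of_not_conn`), so dependence yields a connection.

The rest is combinatorial. If `X` were already an ancestor of `V`, `W` or `S`, conditioning on it
would only remove links; since it creates a `V`–`W` connection, it is no such ancestor. Since it
destroys the `V`–`Y` connection, it is an ancestor of `V`, `Y` or `S`, hence of `Y`. Moreover `V` is
connected to the equation of `X` given `S ∪ {X}` (`Conn.to_conditioned`). If `Y` were an ancestor of
`X`, or confounded with it, this connection would continue to `Y`, which is excluded. -/

theorem SameSCC.symm {u v : N} (h : G.SameSCC u v) : G.SameSCC v u := ⟨h.2, h.1⟩

theorem AncSet.of_anc {u v : N} {C : Set N} (h : G.Anc u v) (hv : G.AncSet v C) : G.AncSet u C :=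
  let ⟨c, hc, hvc⟩ := hv
  ⟨c, hc, h.trans hvc⟩

theorem AncSet.of_mem {u : N} {C : Set N} (h : u ∈ C) : G.AncSet u C :=
  ⟨u, h, Relation.ReflTransGen.refl⟩

theorem AncSet.mono {u : N} {C C' : Set N} (hC : C ⊆ C') (h : G.AncSet u C) : G.AncSet u C' :=
  h.imp fun _ hc => ⟨hC hc.1, hc.2⟩

/-- If the edge leaves a node of `C` with a tail, it does so within a strongly connected
component. -/
def TailOpen (G : DMG N) (C : Set N) : EdgeKind → N → N → Prop
  | EdgeKind.fwd, u, v => G.SameSCC u v ∨ u ∉ C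
  | EdgeKind.bwd, u, v => G.SameSCC v u ∨ v ∉ C
  | EdgeKind.bidir, _, _ => True

namespace Walk

variable {a b : N}

/-- A walk is open if tails at nodes of `C` stay within strongly connected components and all
colliders are ancestors of `C`. -/
def Open (w : G.Walk a b) (C : Set N) : Prop :=
  (∀ i < w.length, G.TailOpen C (w.edge i) (w.node i) (w.node (i + 1))) ∧
  ∀ i, i + 1 < w.length → w.ColliderAt i → G.AncSet (w.node (i + 1)) C

theorem Open.not_sigmaBlocked {w : G.Walk a b} {C : Set N} (hw : w.Open C) (ha : a ∉ C)
    (hb : b ∉ C) : ¬ w.SigmaBlocked C := by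
  rintro (h | h | ⟨i, hi, hc, hn⟩ | ⟨i, hi, -, hC, ⟨he, hs⟩ | ⟨he, hs⟩⟩)
  · exact ha h
  · exact hb h
  · exact hn (hw.2 i hi hc)
  · have := hw.1 i (by omega)
    rw [he] at this
    exact this.elim hs (fun h => h hC)
  · have := hw.1 (i + 1) hi
    rw [he] at this
    exact this.elim hs (fun h => h hC)

/-- After an arrowhead the walk stays directed until it meets a collider, and that collider is an
ancestor of `C`. This controls the collider that cutting out a loop may create. -/
theorem Open.ancSet_or_anc {w : G.Walk a b} {C : Set N} (hw : w.Open C) {j : ℕ}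
    (hj : (w.edge j).HeadAtTarget) (n : ℕ) (hjn : j ≤ n) (hn : n < w.length) :
    G.AncSet (w.node (j + 1)) C ∨
      ((w.edge n).HeadAtTarget ∧ G.Anc (w.node (j + 1)) (w.node (n + 1))) := by
  induction n, hjn using Nat.le_induction with
  | base => exact Or.inr ⟨hj, Relation.ReflTransGen.refl⟩
  | succ n _ ih =>
    rcases ih (by omega) with h | ⟨hh, hanc⟩
    · exact Or.inl h
    · have hcol := hw.2 n hn
      have hedge := w.hasEdge (n + 1) hn
      unfold ColliderAt at hcol
      rcases hk : w.edge (n + 1) with _ | _ | _ <;> rw [hk] at hcol hedge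
      · exact Or.inr ⟨trivial, hanc.tail hedge⟩
      · exact Or.inl ((hcol ⟨hh, trivial⟩).of_anc hanc)
      · exact Or.inl ((hcol ⟨hh, trivial⟩).of_anc hanc)

/-- An open walk that visits a node twice can be shortened. -/
theorem Open.exists_shorter {w : G.Walk a b} {C : Set N} (hw : w.Open C) {i k : ℕ} (hik : i < k)
    (hk : k ≤ w.length) (hnode : w.node i = w.node k) :
    ∃ w' : G.Walk a b, w'.Open C ∧ w'.length < w.length := by
  obtain ⟨d, rfl⟩ : ∃ d, k = i + d := ⟨k - i, by omega⟩
  set nd : ℕ → N := fun j => if j ≤ i then w.node j else w.node (j + d) with hnd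
  set ed : ℕ → EdgeKind := fun j => if j < i then w.edge j else w.edge (j + d) with hed
  have nd_le : ∀ j ≤ i, nd j = w.node j := fun j hj => if_pos hj
  have nd_ge : ∀ j, i ≤ j → nd j = w.node (j + d) := by
    intro j hj
    rcases hj.eq_or_lt with rfl | h
    · exact (if_pos le_rfl).trans hnode
    · exact if_neg (by omega)
  have ed_lt : ∀ j < i, ed j = w.edge j := fun j hj => if_pos hj
  have ed_ge : ∀ j, i ≤ j → ed j = w.edge (j + d) := fun j hj => if_neg (by omega)
  refine ⟨⟨w.length - d, nd, ed, (nd_le 0 (by omega)).trans w.node_zero, ?_, ?_⟩, ⟨?_, ?_⟩, ?_⟩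
  · rw [nd_ge _ (by omega), Nat.sub_add_cancel (by omega), w.node_length]
  · intro j hj
    rcases lt_or_ge j i with h | h
    · rw [ed_lt j h, nd_le j h.le, nd_le (j + 1) h]
      exact w.hasEdge j (by omega)
    · rw [ed_ge j h, nd_ge j h, nd_ge (j + 1) (by omega), show j + 1 + d = j + d + 1 by omega]
      exact w.hasEdge (j + d) (by omega)
  · intro j hj
    change j < w.length - d at hj
    change G.TailOpen C (ed j) (nd j) (nd (j + 1))
    rcases lt_or_ge j i with h | h
    · rw [ed_lt j h, nd_le j h.le, nd_le (j + 1) h]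
      exact hw.1 j (by omega)
    · rw [ed_ge j h, nd_ge j h, nd_ge (j + 1) (by omega), show j + 1 + d = j + d + 1 by omega]
      exact hw.1 (j + d) (by omega)
  · intro j hj hc
    change j + 1 < w.length - d at hj
    change (ed j).HeadAtTarget ∧ (ed (j + 1)).HeadAtSource at hc
    change G.AncSet (nd (j + 1)) C
    rcases lt_trichotomy (j + 1) i with h | h | h
    · rw [ed_lt j (by omega), ed_lt _ h] at hc
      rw [nd_le _ h.le]
      exact hw.2 j (by omega) hc
    -- Only the junction can be a new collider. Either the removed loop contains a collider
    -- descending from it, or the loop is directed throughout and its end was already a collider.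
    · rw [ed_lt j (by omega), ed_ge _ h.ge] at hc
      rw [nd_le _ h.le]
      obtain ⟨n, hn⟩ : ∃ n, j + 1 + d = n + 1 := ⟨j + d, by omega⟩
      rcases hw.ancSet_or_anc hc.1 n (by omega) (by omega) with h' | ⟨hh, -⟩
      · exact h'
      · rw [hn] at hc
        have := hw.2 n (by omega) ⟨hh, hc.2⟩
        rwa [← hn, h, ← hnode, ← h] at this
    · rw [ed_ge j (by omega), ed_ge _ h.le, show j + 1 + d = j + d + 1 by omega] at hc
      rw [nd_ge _ h.le, show j + 1 + d = j + d + 1 by omega]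
      exact hw.2 (j + d) (by omega) hc
  · change w.length - d < w.length
    omega

theorem Open.exists_isPath {w : G.Walk a b} {C : Set N} (hw : w.Open C) :
    ∃ w' : G.Walk a b, w'.Open C ∧ w'.IsPath := by
  induction hn : w.length using Nat.strong_induction_on generalizing w with
  | _ n ih =>
    by_cases hp : w.IsPath
    · exact ⟨w, hw, hp⟩
    · unfold IsPath at hp
      push Not at hp
      obtain ⟨i, j, hi, hj, hij, hne⟩ := hp
      rcases lt_or_gt_of_ne hne with h | h
      · obtain ⟨w', hw', hl⟩ := hw.exists_shorter h hj hij
        exact ih _ (hn ▸ hl) hw' rfl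
      · obtain ⟨w', hw', hl⟩ := hw.exists_shorter h hi hij.symm
        exact ih _ (hn ▸ hl) hw' rfl

/-- The walk without edges. -/
def nil (b : N) : G.Walk b b where
  length := 0
  node _ := b
  edge _ := EdgeKind.fwd
  node_zero := rfl
  node_length := rfl
  hasEdge _ h := absurd h (Nat.not_lt_zero _)

/-- Prepend an edge to a walk. -/
def cons {p u : N} (k : EdgeKind) (h : G.HasEdge k p u) (w : G.Walk u b) : G.Walk p b where
  length := w.length + 1
  node i := Nat.casesOn i p w.node
  edge i := Nat.casesOn i k w.edge
  node_zero := rfl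
  node_length := w.node_length
  hasEdge i hi := by
    cases i with
    | zero =>
      change G.HasEdge k p (w.node 0)
      rwa [w.node_zero]
    | succ i => exact w.hasEdge i (by omega)

theorem Open.nil (b : N) (C : Set N) : (Walk.nil (G := G) b).Open C :=
  ⟨fun _ h => absurd h (Nat.not_lt_zero _), fun _ h => absurd h (Nat.not_lt_zero _)⟩

theorem Open.cons {p u : N} {k : EdgeKind} {h : G.HasEdge k p u} {w : G.Walk u b} {C : Set N}
    (hw : w.Open C) (ht : G.TailOpen C k p u)
    (hc : k.HeadAtTarget → 0 < w.length → (w.edge 0).HeadAtSource → G.AncSet u C) :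
    (w.cons k h).Open C := by
  constructor
  · intro i hi
    cases i with
    | zero =>
      change G.TailOpen C k p (w.node 0)
      rwa [w.node_zero]
    | succ i => exact hw.1 i (Nat.lt_of_succ_lt_succ hi)
  · intro i hi hcol
    cases i with
    | zero =>
      change G.AncSet (w.node 0) C
      rw [w.node_zero]
      exact hc hcol.1 (Nat.lt_of_succ_lt_succ hi) hcol.2
    | succ i => exact hw.2 i (Nat.lt_of_succ_lt_succ hi) hcol

end Walk

/-! ### Moral connections yield open walks -/

/-- There is an open walk from `u` to `b`. -/
def OpenTo (G : DMG N) (C : Set N) (b u : N) : Prop := ∃ w : G.Walk u b, w.Open C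

/-- There is an open walk from `u` to `b` that remains open when any edge is prepended, as far as
its new interior node is concerned. -/
def ExtOpenTo (G : DMG N) (C : Set N) (b u : N) : Prop :=
  ∃ w : G.Walk u b, w.Open C ∧ (0 < w.length → (w.edge 0).HeadAtSource → G.AncSet u C)

section Extend

variable {C : Set N} {a b p q u : N}

theorem ExtOpenTo.openTo (h : G.ExtOpenTo C b u) : G.OpenTo C b u := h.imp fun _ hw => hw.1

theorem extOpenTo_refl (G : DMG N) (C : Set N) (b : N) : G.ExtOpenTo C b b :=
  ⟨Walk.nil b, Walk.Open.nil b C, fun h => absurd h (Nat.lt_irrefl _)⟩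

theorem OpenTo.bwd (h : G.OpenTo C b u) (hd : G.dir u p) (ht : G.SameSCC u p ∨ u ∉ C) :
    G.OpenTo C b p :=
  let ⟨w, hw⟩ := h
  ⟨w.cons EdgeKind.bwd hd, hw.cons ht fun h => h.elim⟩

theorem ExtOpenTo.bidir (h : G.ExtOpenTo C b u) (hd : G.bi p u) : G.OpenTo C b p :=
  let ⟨w, hw, hc⟩ := h
  ⟨w.cons EdgeKind.bidir hd, hw.cons trivial fun _ => hc⟩

theorem ExtOpenTo.fwd (h : G.ExtOpenTo C b u) (hd : G.dir p u) (ht : G.SameSCC p u ∨ p ∉ C) :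
    G.ExtOpenTo C b p :=
  let ⟨w, hw, hc⟩ := h
  ⟨w.cons EdgeKind.fwd hd, hw.cons ht fun _ => hc, fun _ h => h.elim⟩

/-- No node on a directed path from `q` lies in `C`, so the reversed path can be prepended without a
blocked tail or a new collider. -/
theorem OpenTo.of_anc (h : G.OpenTo C b q) (hq : ¬ G.AncSet q C) (ha : G.Anc q a) :
    G.OpenTo C b a := by
  induction ha with
  | refl => exact h
  | tail hqu hd ih => exact ih.bwd hd (Or.inr fun hu => hq ⟨_, hu, hqu⟩)

theorem extOpenTo_of_anc (hq : ¬ G.AncSet q C) (hb : G.Anc q b) : G.ExtOpenTo C b q := by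
  induction hb using Relation.ReflTransGen.head_induction_on with
  | refl => exact extOpenTo_refl G C b
  | head hd hanc ih =>
    exact (ih fun h => hq (h.of_anc (Relation.ReflTransGen.single hd))).fwd hd
      (Or.inr fun hu => hq (AncSet.of_mem hu))

/-- A directed path inside a strongly connected component has no blocked tails, even at nodes of
`C`. -/
theorem ExtOpenTo.of_sameSCC (h : G.ExtOpenTo C b u) (hs : G.SameSCC p u) :
    G.ExtOpenTo C b p := by
  obtain ⟨h1, h2⟩ := hs
  induction h1 using Relation.ReflTransGen.head_induction_on with
  | refl => exact h
  | head hd hanc ih =>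
    exact (ih (h2.tail hd)).fwd hd (Or.inl ⟨Relation.ReflTransGen.single hd, hanc.trans h2⟩)

/-- The ancestors of `{a, b} ∪ C`. -/
def ancestors (G : DMG N) (a b : N) (C : Set N) : Set N :=
  {u | G.AncSet u C ∨ G.Anc u a ∨ G.Anc u b}

/-- The only obstacle is a future collider at `q` that is not an ancestor of `C`. Then `q` is an
ancestor of `a`, and the walk can be finished at once, or of `b`, and the walk can be replaced by a
directed path. -/
theorem OpenTo.extOpenTo_or (h : G.OpenTo C b q) (hq : q ∈ G.ancestors a b C) :
    G.ExtOpenTo C b q ∨ G.OpenTo C b a := by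
  by_cases hC : G.AncSet q C
  · obtain ⟨w, hw⟩ := h
    exact Or.inl ⟨w, hw, fun _ _ => hC⟩
  · rcases hq with hq | hq | hq
    · exact absurd hq hC
    · exact Or.inr (h.of_anc hC hq)
    · exact Or.inl (extOpenTo_of_anc hC hq)

end Extend

/-- One step in the moralization of the acyclification of the subgraph on `D`, with the nodes in `C`
removed; the node `q` also stands for the structural equations of its strongly connected
component. -/
def Step (G : DMG N) (D C : Set N) (q q' : N) : Prop :=
  q ∈ D ∧ q' ∈ D ∧
    (G.SameSCC q q' ∨ G.bi q q' ∨ (G.dir q q' ∧ q ∉ C) ∨ (G.dir q' q ∧ q' ∉ C))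

/-- Connectedness by steps. -/
def Conn (G : DMG N) (D C : Set N) : N → N → Prop := Relation.ReflTransGen (G.Step D C)

theorem Step.symm {D C : Set N} {q q' : N} (h : G.Step D C q q') : G.Step D C q' q := by
  obtain ⟨h1, h2, h3 | h3 | h3 | h3⟩ := h
  · exact ⟨h2, h1, Or.inl h3.symm⟩
  · exact ⟨h2, h1, Or.inr (Or.inl (G.bi_symm _ _ h3))⟩
  · exact ⟨h2, h1, Or.inr (Or.inr (Or.inr h3))⟩
  · exact ⟨h2, h1, Or.inr (Or.inr (Or.inl h3))⟩

/-- The walk is built backwards from `b`, one moral step at a time, keeping it extendable unless an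
open walk from `a` has already been found. -/
theorem Conn.openTo {a b : N} {C : Set N} (h : G.Conn (G.ancestors a b C) C a b) :
    G.OpenTo C b a := by
  suffices ∀ q, G.Conn (G.ancestors a b C) C q b → G.ExtOpenTo C b q ∨ G.OpenTo C b a from
    (this a h).elim ExtOpenTo.openTo id
  intro q hq
  induction hq using Relation.ReflTransGen.head_induction_on with
  | refl => exact Or.inl (extOpenTo_refl G C b)
  | head hstep _ ih =>
    rcases ih with ih | ih
    · obtain ⟨h1, h2, h3 | h3 | ⟨h3, h4⟩ | ⟨h3, h4⟩⟩ := hstep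
      · exact Or.inl (ih.of_sameSCC h3)
      · exact (ih.bidir h3).extOpenTo_or h1
      · exact Or.inl (ih.fwd h3 (Or.inr h4))
      · exact (ih.openTo.bwd h3 (Or.inr h4)).extOpenTo_or h1
    · exact Or.inr ih

/-- Sigma-separated nodes lie in different components of the moralized ancestral graph. -/
theorem SigmaSep.not_conn {a b : N} {C : Set N} (h : G.SigmaSep {a} {b} C) (ha : a ∉ C)
    (hb : b ∉ C) : ¬ G.Conn (G.ancestors a b C) C a b := by
  intro hc
  obtain ⟨w, hw⟩ := hc.openTo
  obtain ⟨w', hw', hp⟩ := hw.exists_isPath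
  exact hw'.not_sigmaBlocked ha hb (h a rfl b rfl w' hp)

end DMG

/-! ### The graphical argument -/

namespace DMG

variable {N : Type*} {G : DMG N}

section Graphical

variable {C C' D D' S : Set N} {a b u v q x V W X Y : N}

theorem mem_ancestors_of_anc (h : G.Anc u v) (hv : v ∈ G.ancestors a b C) :
    u ∈ G.ancestors a b C := by
  rcases hv with hv | hv | hv
  · exact Or.inl (hv.of_anc h)
  · exact Or.inr (Or.inl (h.trans hv))
  · exact Or.inr (Or.inr (h.trans hv))

theorem mem_ancestors_left (G : DMG N) (a b : N) (C : Set N) : a ∈ G.ancestors a b C :=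
  Or.inr (Or.inl Relation.ReflTransGen.refl)

theorem mem_ancestors_right (G : DMG N) (a b : N) (C : Set N) : b ∈ G.ancestors a b C :=
  Or.inr (Or.inr Relation.ReflTransGen.refl)

theorem ancestors_mono (hC : C ⊆ C') : G.ancestors a b C ⊆ G.ancestors a b C' :=
  fun _ h => h.imp_left (AncSet.mono hC)

theorem ancestors_insert_subset (hX : X ∈ G.ancestors a b S) :
    G.ancestors a b (S ∪ {X}) ⊆ G.ancestors a b S := by
  rintro z (⟨c, hc | rfl, hz⟩ | hz)
  · exact Or.inl ⟨c, hc, hz⟩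
  · exact mem_ancestors_of_anc hz hX
  · exact Or.inr hz

theorem ancestors_self_subset (G : DMG N) (a b : N) (C : Set N) :
    G.ancestors a a C ⊆ G.ancestors a b C := by
  rintro z (hz | hz | hz)
  · exact Or.inl hz
  · exact Or.inr (Or.inl hz)
  · exact Or.inr (Or.inl hz)

theorem Step.mono (h : G.Step D C u v) (hD : D ⊆ D') (hC : ∀ z ∈ D, z ∈ C' → z ∈ C) :
    G.Step D' C' u v := by
  obtain ⟨h1, h2, h3 | h3 | h3 | h3⟩ := h
  · exact ⟨hD h1, hD h2, Or.inl h3⟩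
  · exact ⟨hD h1, hD h2, Or.inr (Or.inl h3)⟩
  · exact ⟨hD h1, hD h2, Or.inr (Or.inr (Or.inl ⟨h3.1, fun h => h3.2 (hC _ h1 h)⟩))⟩
  · exact ⟨hD h1, hD h2, Or.inr (Or.inr (Or.inr ⟨h3.1, fun h => h3.2 (hC _ h2 h)⟩))⟩

theorem Conn.mono (h : G.Conn D C u v) (hD : D ⊆ D') (hC : ∀ z ∈ D, z ∈ C' → z ∈ C) :
    G.Conn D' C' u v :=
  Relation.ReflTransGen.mono (fun _ _ hs => hs.mono hD hC) _ _ h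

/-- A connection to `q` extends along a directed path from `q`, if that avoids `C` up to its
end. -/
theorem Conn.of_anc (h : G.Conn D C V q) (hqx : G.Anc q x) (hD : ∀ z, G.Anc z x → z ∈ D)
    (hC : ∀ z, G.Anc q z → z ∈ C → z = x) : G.Conn D C V x := by
  induction hqx using Relation.ReflTransGen.head_induction_on with
  | refl => exact h
  | head hd hanc ih =>
    rename_i p r
    by_cases hp : p = x
    · exact hp ▸ h
    · exact ih (h.tail ⟨hD _ (hanc.head hd), hD _ hanc, Or.inr (Or.inr (Or.inl
        ⟨hd, fun hpC => hp (hC _ Relation.ReflTransGen.refl hpC)⟩))⟩) fun z hz => hC z (hz.head hd)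

/-- If conditioning on `X` in addition to `S` connects `V` and `W`, then `X` is not an ancestor of
`V`, `W` or `S`. -/
theorem not_mem_ancestors_of_conn (h : G.Conn (G.ancestors V W (S ∪ {X})) (S ∪ {X}) V W)
    (h' : ¬ G.Conn (G.ancestors V W S) S V W) : X ∉ G.ancestors V W S := fun hX =>
  h' (h.mono (ancestors_insert_subset hX) fun _ _ hz => Or.inl hz)

/-- If conditioning on `X` in addition to `S` separates `V` and `Y`, then `X` is an ancestor of
`V`, `Y` or `S`. -/
theorem mem_ancestors_of_conn (h : G.Conn (G.ancestors V Y S) S V Y)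
    (h' : ¬ G.Conn (G.ancestors V Y (S ∪ {X})) (S ∪ {X}) V Y) : X ∈ G.ancestors V Y S := by
  by_contra hX
  refine h' (h.mono (ancestors_mono Set.subset_union_left) ?_)
  rintro z hz (h | rfl)
  · exact h
  · exact absurd hz hX

/-- If conditioning on `X` in addition to `S` connects `V` and `W`, then `V` is connected to the
structural equation of `X`. -/
theorem Conn.to_conditioned (h : G.Conn (G.ancestors V W (S ∪ {X})) (S ∪ {X}) V W)
    (h' : ¬ G.Conn (G.ancestors V W S) S V W) :
    G.Conn (G.ancestors V V (S ∪ {X})) (S ∪ {X}) V X := by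
  have hX := not_mem_ancestors_of_conn h h'
  suffices ∀ u, G.Conn (G.ancestors V W (S ∪ {X})) (S ∪ {X}) V u →
      G.Conn (G.ancestors V V (S ∪ {X})) (S ∪ {X}) V X ∨
        (u ∈ G.ancestors V V S ∧ G.Conn (G.ancestors V V S) S V u) by
    rcases this W h with h | ⟨-, h⟩
    · exact h
    · exact absurd (h.mono (ancestors_self_subset G V W S) fun _ _ => id) h'
  intro u hu
  induction hu with
  | refl => exact Or.inr ⟨mem_ancestors_left G V V S, Relation.ReflTransGen.refl⟩
  | @tail u v _ hstep ih =>
    rcases ih with ih | ⟨hu, ih⟩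
    · exact Or.inl ih
    have hstep' : ∀ D : Set N, u ∈ D → v ∈ D → G.Step D (S ∪ {X}) u v :=
      fun D hu hv => ⟨hu, hv, hstep.2.2⟩
    by_cases hv : v ∈ G.ancestors V V S
    · exact Or.inr ⟨hv, ih.tail ((hstep' _ hu hv).mono subset_rfl fun _ _ hz => Or.inl hz)⟩
    -- Here the connection first leaves the ancestors of `V` and `S`. From `v` a directed path leads
    -- to `W` or to `X`, and it avoids `S`.
    have hvS : ¬ G.AncSet v S := fun h => hv (Or.inl h)
    by_cases hvW : G.Anc v W
    · refine absurd ?_ h'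
      have hv' : v ∈ G.ancestors V W S := Or.inr (Or.inr hvW)
      have hVv : G.Conn (G.ancestors V W S) S V v :=
        (ih.mono (ancestors_self_subset G V W S) fun _ _ => id).tail
          ((hstep' _ (ancestors_self_subset G V W S hu) hv').mono subset_rfl
            fun _ _ hz => Or.inl hz)
      exact hVv.of_anc hvW (fun z hz => Or.inr (Or.inr hz)) fun z hz hzS => absurd ⟨z, hzS, hz⟩ hvS
    · have hvX : G.Anc v X := by
        rcases hstep.2.1 with ⟨c, hc | rfl, hvc⟩ | h | h
        · exact absurd ⟨c, hc, hvc⟩ hvS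
        · exact hvc
        · exact absurd (Or.inr (Or.inl h)) hv
        · exact absurd h hvW
      have hsub : G.ancestors V V S ⊆ G.ancestors V V (S ∪ {X}) :=
        ancestors_mono Set.subset_union_left
      have hXD : ∀ z, G.Anc z X → z ∈ G.ancestors V V (S ∪ {X}) :=
        fun z hz => Or.inl ⟨X, Or.inr rfl, hz⟩
      have hVv : G.Conn (G.ancestors V V (S ∪ {X})) (S ∪ {X}) V v := by
        refine (ih.mono hsub ?_).tail (hstep' _ (hsub hu) (hXD v hvX))
        rintro z hz (h | rfl)
        · exact h
        · exact absurd (ancestors_self_subset G V W S hz) hX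
      refine Or.inl (hVv.of_anc hvX hXD ?_)
      rintro z hz (h | rfl)
      · exact absurd ⟨z, h, hz⟩ hvS
      · rfl

/-- Until the first edge with an arrowhead at its target, all edges point back towards `u`. Absence
of colliders forbids a backward edge after such an arrowhead. -/
theorem Walk.IsConfounding.anc_or_head {w : G.Walk u v} {O : Set N} (hw : w.IsConfounding O)
    (i : ℕ) (hi : i < w.length) : G.Anc (w.node (i + 1)) u ∨ (w.edge i).HeadAtTarget := by
  induction i with
  | zero =>
    have h0 := hw.2.1
    rcases hk : w.edge 0 with _ | _ | _ <;> rw [hk] at h0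
    · exact h0.elim
    · have := w.hasEdge 0 hi
      rw [hk, w.node_zero] at this
      exact Or.inl (Relation.ReflTransGen.single this)
    · exact Or.inr trivial
  | succ i ih =>
    rcases hk : w.edge (i + 1) with _ | _ | _
    · exact Or.inr trivial
    · have hedge := w.hasEdge (i + 1) hi
      rw [hk] at hedge
      rcases ih (by omega) with h | h
      · exact Or.inl (Relation.ReflTransGen.head hedge h)
      · refine absurd ⟨h, ?_⟩ (hw.2.2.2 i hi).1
        rw [hk]
        trivial
    · exact Or.inr trivial

theorem Walk.IsConfounding.anc_of_head {w : G.Walk u v} {O : Set N} (hw : w.IsConfounding O)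
    (n i : ℕ) (hi : i + 1 + n = w.length) (hh : (w.edge i).HeadAtTarget) :
    G.Anc (w.node (i + 1)) v := by
  induction n generalizing i with
  | zero =>
    rw [show i + 1 = w.length from hi, w.node_length]
    exact Relation.ReflTransGen.refl
  | succ n ih =>
    have hcol := (hw.2.2.2 i (by omega)).1
    have hedge := w.hasEdge (i + 1) (by omega)
    unfold ColliderAt at hcol
    rcases hk : w.edge (i + 1) with _ | _ | _ <;> rw [hk] at hcol hedge
    · refine Relation.ReflTransGen.head hedge (ih (i + 1) (by omega) ?_)
      rw [hk]
      trivial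
    · exact absurd ⟨hh, trivial⟩ hcol
    · exact absurd ⟨hh, trivial⟩ hcol

theorem Walk.IsConfounding.anc {w : G.Walk u v} {O : Set N} (hw : w.IsConfounding O) (i : ℕ)
    (hi : i ≤ w.length) : G.Anc (w.node i) u ∨ G.Anc (w.node i) v := by
  cases i with
  | zero =>
    rw [w.node_zero]
    exact Or.inl Relation.ReflTransGen.refl
  | succ i =>
    exact (hw.anc_or_head i hi).imp_right (hw.anc_of_head (w.length - (i + 1)) i (by omega))

/-- The end nodes of a confounding walk are connected. -/
theorem Walk.IsConfounding.conn {w : G.Walk u v} {O : Set N} (hw : w.IsConfounding O)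
    (hC : C ⊆ O) (hu : ∀ z, G.Anc z u → z ∈ D) (hv : ∀ z, G.Anc z v → z ∈ D) :
    G.Conn D C u v := by
  have hD : ∀ i ≤ w.length, w.node i ∈ D := fun i hi => (hw.anc i hi).elim (hu _) (hv _)
  suffices ∀ i ≤ w.length, G.Conn D C u (w.node i) from w.node_length ▸ this _ le_rfl
  intro i hi
  induction i with
  | zero =>
    rw [w.node_zero]
    exact Relation.ReflTransGen.refl
  | succ i ih =>
    refine (ih (by omega)).tail ⟨hD i (by omega), hD _ hi, ?_⟩
    have hedge := w.hasEdge i hi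
    rcases hk : w.edge i with _ | _ | _ <;> rw [hk] at hedge
    -- Tails occur only at interior nodes, which avoid `C`. The end nodes may lie in `C`, since the
    -- walk has arrowheads there.
    · refine Or.inr (Or.inr (Or.inl ⟨hedge, fun h => ?_⟩))
      cases i with
      | zero => exact absurd hw.2.1 (hk ▸ id)
      | succ i => exact (hw.2.2.2 i hi).2 (hC h)
    · refine Or.inr (Or.inr (Or.inr ⟨hedge, fun h => ?_⟩))
      by_cases hl : i + 1 = w.length
      · refine absurd hw.2.2.1 ?_
        rw [← hl, Nat.add_sub_cancel, hk]
        exact id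
      · exact (hw.2.2.2 i (by omega)).2 (hC h)
    · exact Or.inr (Or.inl hedge)

/-- A bidirected edge is a confounding walk. -/
theorem Confounded.of_bi (O : Set N) (h : G.bi u v) : G.Confounded O u v :=
  ⟨⟨1, fun i => Nat.casesOn i u fun _ => v, fun _ => EdgeKind.bidir, rfl, rfl, fun i hi => by
      obtain rfl : i = 0 := by omega
      exact h⟩,
    Nat.one_pos, trivial, trivial, fun i hi => absurd hi (by simp)⟩

/-- The graphical conclusions drawn from a minimal separation and a minimal connection. -/
theorem unconfounded_ancestor_of_conn
    (hVY : G.Conn (G.ancestors V Y S) S V Y)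
    (hVY' : ¬ G.Conn (G.ancestors V Y (S ∪ {X})) (S ∪ {X}) V Y)
    (hVW : G.Conn (G.ancestors V W (S ∪ {X})) (S ∪ {X}) V W)
    (hVW' : ¬ G.Conn (G.ancestors V W S) S V W) :
    G.Anc X Y ∧ ¬ G.Anc Y X ∧ ¬ G.AncSet X S ∧ ¬ G.bi X Y ∧
      ¬ G.Confounded (S ∪ {X, Y}) X Y := by
  have hX := not_mem_ancestors_of_conn hVW hVW'
  have hXS : ¬ G.AncSet X S := fun h => hX (Or.inl h)
  have hXY : G.Anc X Y := by
    rcases mem_ancestors_of_conn hVY hVY' with h | h | h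
    · exact absurd h hXS
    · exact absurd (Or.inr (Or.inl h)) hX
    · exact h
  have hVX : G.Conn (G.ancestors V Y (S ∪ {X})) (S ∪ {X}) V X :=
    (hVW.to_conditioned hVW').mono (ancestors_self_subset G V Y _) fun _ _ => id
  have hXD : ∀ z, G.Anc z X → z ∈ G.ancestors V Y (S ∪ {X}) :=
    fun z hz => Or.inl ⟨X, Or.inr rfl, hz⟩
  have hYD : ∀ z, G.Anc z Y → z ∈ G.ancestors V Y (S ∪ {X}) := fun z hz => Or.inr (Or.inr hz)
  have hconf : ¬ G.Confounded (S ∪ {X, Y}) X Y := by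
    rintro ⟨w, hw⟩
    refine hVY' (hVX.trans (hw.conn ?_ hXD hYD))
    rintro z (h | rfl)
    · exact Or.inl h
    · exact Or.inr (Or.inl rfl)
  refine ⟨hXY, fun hYX => hVY' (hVX.tail ?_), hXS, fun h => hconf (.of_bi _ h), hconf⟩
  -- A cycle through `X` and `Y` gives a step within one component, which conditioning on `X` does
  -- not remove.
  exact ⟨hXD X Relation.ReflTransGen.refl, hXD Y hYX, Or.inl ⟨hXY, hYX⟩⟩

end Graphical

end DMG

/-! ### Calculus of conditional independence -/

section CondIndepLemmas

variable {Ω : Type*} {m m' m₁ m₁' m₂ : MeasurableSpace Ω} [mΩ : MeasurableSpace Ω]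
  {μ : Measure Ω} [IsProbabilityMeasure μ]

theorem condExp_inter_ae_eq {s t : Set Ω} (hs : MeasurableSet[m] s)
    (ht : MeasurableSet t) : μ⟦s ∩ t | m⟧ =ᵐ[μ] s.indicator (μ⟦t | m⟧) := by
  have : (s ∩ t).indicator (fun _ => (1 : ℝ)) = s.indicator (t.indicator fun _ => (1 : ℝ)) := by
    rw [Set.indicator_indicator]
  rw [this]
  exact condExp_indicator ((integrable_const 1).indicator ht) hs

/-- The sets `u ∩ v` form a π-system generating the join, and the indicator of the `m`-measurable
set `u` factors out of conditional expectations. -/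
theorem ProbabilityTheory.CondIndep.sup_left [StandardBorelSpace Ω] {hm : m ≤ mΩ} (hm₁ : m₁ ≤ mΩ) (hm₂ : m₂ ≤ mΩ)
    (h : CondIndep m m₁ m₂ hm μ) : CondIndep m (m ⊔ m₁) m₂ hm μ := by
  let p : Set (Set Ω) := {s | ∃ u v, MeasurableSet[m] u ∧ MeasurableSet[m₁] v ∧ u ∩ v = s}
  have hp : IsPiSystem p := by
    rintro _ ⟨u, v, hu, hv, rfl⟩ _ ⟨u', v', hu', hv', rfl⟩ -
    exact ⟨u ∩ u', v ∩ v', hu.inter hu', hv.inter hv', by rw [Set.inter_inter_inter_comm]⟩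
  have hgen : m ⊔ m₁ = MeasurableSpace.generateFrom p := by
    apply le_antisymm
    · refine sup_le (fun s hs => ?_) fun s hs => ?_
      · exact MeasurableSpace.measurableSet_generateFrom
          ⟨s, Set.univ, hs, MeasurableSet.univ, Set.inter_univ s⟩
      · exact MeasurableSpace.measurableSet_generateFrom
          ⟨Set.univ, s, MeasurableSet.univ, hs, Set.univ_inter s⟩
    · refine MeasurableSpace.generateFrom_le ?_
      rintro _ ⟨u, v, hu, hv, rfl⟩
      exact MeasurableSet.inter (le_sup_left (a := m) _ hu) (le_sup_right (a := m) _ hv)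
  refine CondIndepSets.condIndep (sup_le hm hm₁) hm₂ hp
    (@MeasurableSpace.isPiSystem_measurableSet Ω m₂) hgen
    (@MeasurableSpace.generateFrom_measurableSet Ω m₂).symm ?_
  rw [condIndepSets_iff]
  · rintro _ t ⟨u, v, hu, hv, rfl⟩ ht
    have hv' := hm₁ _ hv
    have ht' := hm₂ _ ht
    rw [Set.inter_assoc]
    filter_upwards [condExp_inter_ae_eq hu (hv'.inter ht'), condExp_inter_ae_eq hu hv',
      (condIndep_iff m m₁ m₂ hm hm₁ hm₂ μ).1 h v t hv ht] with ω h1 h2 h3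
    rw [h1, Pi.mul_apply, h2]
    by_cases hω : ω ∈ u
    · rw [Set.indicator_of_mem hω, Set.indicator_of_mem hω, h3, Pi.mul_apply]
    · rw [Set.indicator_of_notMem hω, Set.indicator_of_notMem hω, zero_mul]
  · rintro _ ⟨u, v, hu, hv, rfl⟩
    exact (hm _ hu).inter (hm₁ _ hv)
  · exact fun s hs => hm₂ s hs

theorem condExp_mul_indicator {s t : Set Ω}
    (hs : MeasurableSet s) :
    μ[s.indicator (μ⟦t | m⟧) | m] =ᵐ[μ] μ⟦s | m⟧ * μ⟦t | m⟧ := by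
  have hst : (s.indicator fun _ => (1 : ℝ)) * μ⟦t | m⟧ = s.indicator (μ⟦t | m⟧) := by
    ext ω
    by_cases hω : ω ∈ s <;> simp [hω]
  rw [← hst]
  refine condExp_mul_of_stronglyMeasurable_right stronglyMeasurable_condExp ?_
    ((integrable_const 1).indicator hs)
  rw [hst]
  exact integrable_condExp.indicator hs

/-- Conditionally on `m`, the larger sigma-algebra `m₁` is irrelevant for `m₂`. -/
theorem ProbabilityTheory.CondIndep.condExp_eq [StandardBorelSpace Ω] {hm : m ≤ mΩ} (hm₁ : m₁ ≤ mΩ) (hm₂ : m₂ ≤ mΩ) (hmm₁ : m ≤ m₁)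
    (h : CondIndep m m₁ m₂ hm μ) {t : Set Ω} (ht : MeasurableSet[m₂] t) :
    μ⟦t | m⟧ =ᵐ[μ] μ⟦t | m₁⟧ := by
  have ht' := hm₂ _ ht
  refine ae_eq_condExp_of_forall_setIntegral_eq hm₁ ((integrable_const 1).indicator ht')
    (fun s _ _ => integrable_condExp.integrableOn) (fun s hs _ => ?_)
    (stronglyMeasurable_condExp.mono hmm₁).aestronglyMeasurable
  have hs' := hm₁ _ hs
  have key : μ[s.indicator (μ⟦t | m⟧) | m] =ᵐ[μ] μ⟦s ∩ t | m⟧ :=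
    (condExp_mul_indicator hs').trans
      ((condIndep_iff m m₁ m₂ hm hm₁ hm₂ μ).1 h s t hs ht).symm
  rw [← integral_indicator hs', ← integral_indicator hs', ← integral_condExp hm,
    integral_congr_ae key, integral_condExp hm, Set.indicator_indicator]

/-- Decomposition, weak union and determinism: the conditioning sigma-algebra may be enlarged, and
the first sigma-algebra replaced, by what they jointly determine. -/
theorem ProbabilityTheory.CondIndep.of_le_sup [StandardBorelSpace Ω] {hm : m ≤ mΩ} (hm₁ : m₁ ≤ mΩ) (hm₂ : m₂ ≤ mΩ)
    (h : CondIndep m m₁ m₂ hm μ) (hm' : m' ≤ mΩ) (hmm' : m ≤ m') (hm'₁ : m' ≤ m ⊔ m₁)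
    (hm₁' : m₁' ≤ m ⊔ m₁) : CondIndep m' m₁' m₂ hm' μ := by
  have hM : m ⊔ m₁ ≤ mΩ := sup_le hm hm₁
  have h' := h.sup_left hm₁ hm₂
  refine condIndep_of_condIndep_of_le_left ?_ hm₁'
  rw [condIndep_iff _ _ _ hm' hM hm₂]
  intro s t hs ht
  have ht' := hm₂ _ ht
  -- Both sides agree with the conditional probability given `m`; the tower property then transfers
  -- the factorization to `m'`.
  have e : μ⟦t | m'⟧ =ᵐ[μ] μ⟦t | m ⊔ m₁⟧ :=
    ((condIndep_of_condIndep_of_le_left h' hm'₁).condExp_eq hm' hm₂ hmm' ht).symm.trans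
      (h'.condExp_eq hM hm₂ le_sup_left ht)
  have e2 : μ⟦s ∩ t | m ⊔ m₁⟧ =ᵐ[μ] s.indicator (μ⟦t | m'⟧) := by
    filter_upwards [condExp_inter_ae_eq (μ := μ) hs ht', e] with ω h1 h2
    rw [h1]
    by_cases hω : ω ∈ s
    · rw [Set.indicator_of_mem hω, Set.indicator_of_mem hω, h2]
    · rw [Set.indicator_of_notMem hω, Set.indicator_of_notMem hω]
  exact (condExp_condExp_of_le hm'₁ hM).symm.trans
    ((condExp_congr_ae e2).trans (condExp_mul_indicator (hM _ hs)))

theorem condIndep_bot_of_indep [StandardBorelSpace Ω] (hm₁ : m₁ ≤ mΩ) (hm₂ : m₂ ≤ mΩ) (h : Indep m₁ m₂ μ) :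
    CondIndep ⊥ m₁ m₂ bot_le μ := by
  rw [condIndep_iff _ _ _ bot_le hm₁ hm₂]
  intro s t hs ht
  have hi : ∀ u : Set Ω, MeasurableSet u → ∫ ω, u.indicator (fun _ => (1 : ℝ)) ω ∂μ = μ.real u :=
    fun u hu => by rw [integral_indicator hu, setIntegral_const, smul_eq_mul, mul_one]
  rw [condExp_bot, condExp_bot, condExp_bot, hi s (hm₁ _ hs), hi t (hm₂ _ ht),
    hi _ ((hm₁ _ hs).inter (hm₂ _ ht))]
  refine Filter.Eventually.of_forall fun ω => ?_
  simp only [Pi.mul_apply, measureReal_def, (Indep_iff m₁ m₂ μ).1 h s t hs ht, ENNReal.toReal_mul]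

end CondIndepLemmas

/-! ### Invariance under null-set modifications -/

section Modification

variable {Ω : Type*} [mΩ : MeasurableSpace Ω] {μ : Measure Ω} {α : Type*} [MeasurableSpace α]

/-- Conditional expectations given almost surely equal random variables agree. -/
theorem condExp_comap_congr [IsProbabilityMeasure μ] {φ ψ : Ω → α} (hφ : Measurable φ) (hψ : Measurable ψ)
    (h : φ =ᵐ[μ] ψ) {f : Ω → ℝ} (hf : Integrable f μ) :
    μ[f | MeasurableSpace.comap φ inferInstance] =ᵐ[μ]
      μ[f | MeasurableSpace.comap ψ inferInstance] := by
  -- By the Doob–Dynkin factorization, the conditional expectation is a function `k` of `φ`; the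
  -- same `k` serves for `ψ`.
  obtain ⟨k, hk, hkφ⟩ := (stronglyMeasurable_condExp (μ := μ) (f := f)
    (m := MeasurableSpace.comap φ inferInstance)).measurable.exists_eq_measurable_comp
  have hkψ : μ[f | MeasurableSpace.comap φ inferInstance] =ᵐ[μ] k ∘ ψ := by
    rw [hkφ]
    filter_upwards [h] with ω hω
    rw [Function.comp_apply, Function.comp_apply, hω]
  refine ae_eq_condExp_of_forall_setIntegral_eq hψ.comap_le hf
    (fun s _ _ => integrable_condExp.integrableOn) ?_ ⟨k ∘ ψ, ?_, hkψ⟩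
  · rintro _ ⟨B, hB, rfl⟩ -
    have hBe : ψ ⁻¹' B =ᵐ[μ] φ ⁻¹' B := by
      filter_upwards [h] with ω hω
      exact congrArg B hω.symm
    rw [setIntegral_congr_set hBe, setIntegral_congr_set hBe,
      setIntegral_condExp hφ.comap_le hf ⟨B, hB, rfl⟩]
  · exact (hk.comp (comap_measurable ψ)).stronglyMeasurable

variable {I : Type*} {X : I → Type*} [∀ i, MeasurableSpace (X i)]

theorem sigmaOf_eq_comap {Ω : Type*} (x : ∀ i, Ω → X i) (A : Set I) :
    sigmaOf x A = MeasurableSpace.comap (fun ω (i : A) => x i ω) MeasurableSpace.pi := by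
  rw [MeasurableSpace.pi, MeasurableSpace.comap_iSup, iSup_subtype]
  simp only [MeasurableSpace.comap_comp]
  rfl

theorem exists_measurableSet_sigmaOf_ae_eq [Countable I] {x x' : ∀ i, Ω → X i}
    (h : ∀ i, x i =ᵐ[μ] x' i) (A : Set I) {t : Set Ω} (ht : MeasurableSet[sigmaOf x A] t) :
    ∃ t', MeasurableSet[sigmaOf x' A] t' ∧ t =ᵐ[μ] t' := by
  rw [sigmaOf_eq_comap] at ht
  obtain ⟨B, hB, rfl⟩ := ht
  refine ⟨(fun ω (i : A) => x' i ω) ⁻¹' B, ?_, ?_⟩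
  · rw [sigmaOf_eq_comap]
    exact ⟨B, hB, rfl⟩
  · filter_upwards [ae_all_iff.2 h] with ω hω
    exact congrArg B (funext fun i => hω i)

/-- The generated sigma-algebras may differ, but their events correspond up to null sets. This
permits replacing a solution by one that solves the equations everywhere. -/
theorem CI.congr_ae [IsProbabilityMeasure μ] [StandardBorelSpace Ω] [Countable I] {x x' : ∀ i, Ω → X i}
    {hx : ∀ i, Measurable (x i)} {hx' : ∀ i, Measurable (x' i)} (h : ∀ i, x i =ᵐ[μ] x' i)
    {A B C : Set I} (hCI : CI μ hx' A B C) : CI μ hx A B C := by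
  unfold CI at hCI ⊢
  rw [condIndep_iff _ _ _ _ (sigmaOf_le ‹_› _) (sigmaOf_le ‹_› _)] at hCI ⊢
  have hC : ∀ t t' : Set Ω, MeasurableSet t → t =ᵐ[μ] t' →
      μ⟦t | sigmaOf x C⟧ =ᵐ[μ] μ⟦t' | sigmaOf x' C⟧ := by
    intro t t' ht htt'
    rw [sigmaOf_eq_comap, sigmaOf_eq_comap]
    refine (condExp_comap_congr (measurable_pi_lambda _ fun i : C => hx i)
      (measurable_pi_lambda _ fun i : C => hx' i) ?_ ((integrable_const 1).indicator ht)).trans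
      (condExp_congr_ae (indicator_ae_eq_of_ae_eq_set htt'))
    filter_upwards [ae_all_iff.2 h] with ω hω
    exact funext fun i => hω i
  intro s t hs ht
  obtain ⟨s', hs', hss'⟩ := exists_measurableSet_sigmaOf_ae_eq h A hs
  obtain ⟨t', ht', htt'⟩ := exists_measurableSet_sigmaOf_ae_eq h B ht
  have hsm := sigmaOf_le hx A _ hs
  have htm := sigmaOf_le hx B _ ht
  exact (hC _ _ (hsm.inter htm) (hss'.inter htt')).trans
    ((hCI s' t' hs' ht').trans ((hC _ _ hsm hss').mul (hC _ _ htm htt')).symm)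

end Modification

/-! ### The global Markov property -/

section Markov

theorem sigmaOf_mono {Ω I : Type*} {X : I → Type*} [∀ i, MeasurableSpace (X i)]
    (x : ∀ i, Ω → X i) {A B : Set I} (h : A ⊆ B) : sigmaOf x A ≤ sigmaOf x B :=
  biSup_mono fun _ hi => h hi

theorem comap_le_sigmaOf {Ω I : Type*} {X : I → Type*} [∀ i, MeasurableSpace (X i)]
    (x : ∀ i, Ω → X i) {A : Set I} {i : I} (hi : i ∈ A) :
    MeasurableSpace.comap (x i) inferInstance ≤ sigmaOf x A :=
  le_iSup₂_of_le i hi le_rfl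

variable {I J : Type*} {X : I → Type*} {E : J → Type*}
  [∀ i, MeasurableSpace (X i)] [∀ j, MeasurableSpace (E j)] {Ω : Type*}

/-- For every set of endogenous variables, the random variables `x` in it are determined by their
parents outside of it and the exogenous random variables `e`. -/
def SCM.Determines (M : SCM I J X E) (x : ∀ i, Ω → X i) (e : ∀ j, Ω → E j) : Prop :=
  ∀ (O : Set I) (m : MeasurableSpace Ω),
    (∀ k ∉ O, (∃ i ∈ O, M.pa k i) → MeasurableSpace.comap (x k) inferInstance ≤ m) →
    (∀ j, (∃ i ∈ O, M.exoPa j i) → MeasurableSpace.comap (e j) inferInstance ≤ m) →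
    ∀ i ∈ O, MeasurableSpace.comap (x i) inferInstance ≤ m

variable [mΩ : MeasurableSpace Ω] {μ : Measure Ω} [IsProbabilityMeasure μ]

/-- A solution of a simple model can be modified on a null set such that all structural equations
are solved everywhere. -/
theorem SCM.IsSolution.exists_determines [Finite I] [Fintype J] {M : SCM I J X E}
    (hM : M.IsSimple) {x : ∀ i, Ω → X i} (hx : ∀ i, Measurable (x i)) (h : M.IsSolution μ x) :
    ∃ (x' : ∀ i, Ω → X i) (e : ∀ j, Ω → E j), (∀ i, Measurable (x' i)) ∧
      (∀ j, Measurable (e j)) ∧ (∀ i, x i =ᵐ[μ] x' i) ∧ iIndepFun e μ ∧ M.Determines x' e := by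
  classical
  obtain ⟨e, he, hmap, heq⟩ := h
  choose g hg hsolve using hM
  -- One null set serves for all `O`, because there are only finitely many sets of endogenous
  -- variables.
  have hall : ∀ᵐ ω ∂μ, ∀ (O : Set I) (i : O),
      x i.1 ω = g O (fun k => x k.1 ω, fun j => e ω j.1) i := by
    have h1 : ∀ᵐ ω ∂μ, ∀ O : Set I, ∀ y : ∀ i, X i,
        (∀ i : O, y i.1 = g O (fun k => y k.1, fun j => e ω j.1) i) ↔
          (∀ i : O, y i.1 = M.rhs y (e ω) i.1) :=
      ae_all_iff.2 fun O => ae_of_ae_map he.aemeasurable (hmap ▸ hsolve O)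
    filter_upwards [h1, heq] with ω hω hω' O
    exact (hω O fun i => x i ω).2 fun i => hω' i
  obtain ⟨ω₀, hω₀⟩ := hall.exists
  obtain ⟨B, hB, hBm, hB0⟩ := exists_measurable_superset_of_null (ae_iff.1 hall)
  -- Exceptional outcomes are rerouted to one good outcome, so that determination becomes an exact
  -- inclusion of sigma-algebras.
  let r : Ω → Ω := fun ω => if ω ∈ B then ω₀ else ω
  have hr : Measurable r := Measurable.ite hBm measurable_const measurable_id
  have hr_ae : ∀ᵐ ω ∂μ, r ω = ω := by
    filter_upwards [measure_eq_zero_iff_ae_notMem.1 hB0] with ω hω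
    exact if_neg hω
  have hr_eq : ∀ (ω : Ω) (O : Set I) (i : O),
      x i.1 (r ω) = g O (fun k => x k.1 (r ω), fun j => e (r ω) j.1) i := by
    intro ω
    by_cases hω : ω ∈ B
    · rw [show r ω = ω₀ from if_pos hω]
      exact hω₀
    · rw [show r ω = ω from if_neg hω]
      by_contra hn
      exact hω (hB hn)
  have hej : ∀ j, Measurable fun ω => e (r ω) j :=
    fun j => (measurable_pi_apply j).comp (he.comp hr)
  refine ⟨fun i ω => x i (r ω), fun j ω => e (r ω) j, fun i => (hx i).comp hr, hej, ?_, ?_, ?_⟩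
  · intro i
    filter_upwards [hr_ae] with ω hω
    rw [hω]
  · have := M.isProbabilityMeasure_noise
    have hmap' : μ.map (fun ω => e (r ω)) = Measure.pi M.noise := by
      rw [← show M.noiseLaw = Measure.pi M.noise from rfl, ← hmap]
      refine Measure.map_congr ?_
      filter_upwards [hr_ae] with ω hω
      rw [hω]
    rw [iIndepFun_iff_map_fun_eq_pi_map fun j => (hej j).aemeasurable]
    refine hmap'.trans (congrArg Measure.pi (funext fun j => ?_))
    rw [← (measurePreserving_eval M.noise j).map_eq, ← hmap']
    exact Measure.map_map (μ := μ) (f := fun ω => e (r ω)) (measurable_pi_apply j) (he.comp hr)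
  · intro O m hk hj i hi
    rw [← measurable_iff_comap_le]
    have hfun : (fun ω => x i (r ω)) = fun ω =>
        g O (fun k => x k.1 (r ω), fun j => e (r ω) j.1) ⟨i, hi⟩ :=
      funext fun ω => hr_eq ω O ⟨i, hi⟩
    change Measurable fun ω => x i (r ω)
    rw [hfun]
    refine (measurable_pi_apply _).comp ((hg O).comp (Measurable.prodMk ?_ ?_))
    · exact measurable_pi_lambda _ fun k => measurable_iff_comap_le.2 (hk k.1 k.2.1 k.2.2)
    · exact measurable_pi_lambda _ fun j => measurable_iff_comap_le.2 (hj j.1 j.2)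

/-- Conditional independence of two groups of variables is preserved when a strongly connected
component all of whose structural equations belong to the first group is added. -/
theorem SCM.Determines.condIndep_of_diff [StandardBorelSpace Ω] {M : SCM I J X E}
    {x : ∀ i, Ω → X i} {e : ∀ j, Ω → E j} (hdet : M.Determines x e) (hx : ∀ i, Measurable (x i))
    (he : ∀ j, Measurable (e j)) {C P P' Q T : Set I} {R R' : Set J}
    (hQP' : ∀ i ∈ Q, i ∉ P')
    (hpa : ∀ i ∈ Q, ∀ k ∉ Q, M.pa k i → k ∈ T ∧ (k ∈ C ∨ k ∈ P))
    (hexo : ∀ i ∈ Q, ∀ j, M.exoPa j i → j ∈ R)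
    (h : CondIndep (sigmaOf x ((T \ Q) ∩ C)) (sigmaOf e R ⊔ sigmaOf x (((T \ Q) ∩ P) \ C))
      (sigmaOf e R' ⊔ sigmaOf x (((T \ Q) ∩ P') \ C)) (sigmaOf_le hx _) μ) :
    CondIndep (sigmaOf x (T ∩ C)) (sigmaOf e R ⊔ sigmaOf x ((T ∩ P) \ C))
      (sigmaOf e R' ⊔ sigmaOf x ((T ∩ P') \ C)) (sigmaOf_le hx _) μ := by
  have hP' : (T ∩ P') \ C ⊆ ((T \ Q) ∩ P') \ C :=
    fun i hi => ⟨⟨⟨hi.1.1, fun hQ => hQP' i hQ hi.1.2⟩, hi.1.2⟩, hi.2⟩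
  have hle : ∀ (R : Set J) (A : Set I), sigmaOf e R ⊔ sigmaOf x A ≤ mΩ :=
    fun R A => sup_le (sigmaOf_le he R) (sigmaOf_le hx A)
  -- Unique solvability makes all of `Q` a function of the conditioning variables and the first
  -- group, so its members may join either of these.
  have hQ : ∀ i ∈ Q, MeasurableSpace.comap (x i) inferInstance ≤
      sigmaOf x ((T \ Q) ∩ C) ⊔ (sigmaOf e R ⊔ sigmaOf x (((T \ Q) ∩ P) \ C)) := by
    refine hdet Q _ ?_ ?_
    · rintro k hkQ ⟨i, hi, hki⟩
      obtain ⟨hkT, hk⟩ := hpa i hi k hkQ hki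
      by_cases hkC : k ∈ C
      · exact le_sup_of_le_left (comap_le_sigmaOf x ⟨⟨hkT, hkQ⟩, hkC⟩)
      · exact le_sup_of_le_right (le_sup_of_le_right
          (comap_le_sigmaOf x ⟨⟨⟨hkT, hkQ⟩, hk.resolve_left hkC⟩, hkC⟩))
    · rintro j ⟨i, hi, hji⟩
      exact le_sup_of_le_right (le_sup_of_le_left (comap_le_sigmaOf e (hexo i hi j hji)))
  refine condIndep_of_condIndep_of_le_right ?_ (sup_le_sup_left (sigmaOf_mono x hP') _)
  refine h.of_le_sup (hle _ _) (hle _ _) _ (sigmaOf_mono x fun i hi => ⟨hi.1.1, hi.2⟩) ?_ ?_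
  · refine iSup₂_le fun i hi => ?_
    by_cases hiQ : i ∈ Q
    · exact hQ i hiQ
    · exact le_sup_of_le_left (comap_le_sigmaOf x ⟨⟨hi.1, hiQ⟩, hi.2⟩)
  · refine sup_le (le_sup_of_le_right le_sup_left) (iSup₂_le fun i hi => ?_)
    by_cases hiQ : i ∈ Q
    · exact hQ i hiQ
    · exact le_sup_of_le_right (le_sup_of_le_right
        (comap_le_sigmaOf x ⟨⟨⟨hi.1.1, hiQ⟩, hi.1.2⟩, hi.2⟩))

/-- A nonempty finite set of nodes has an element all of whose descendants in the set lie in its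
strongly connected component. -/
theorem DMG.exists_sink {N : Type*} [Finite N] (G : DMG N) {T : Set N} (hT : T.Nonempty) :
    ∃ q ∈ T, ∀ r ∈ T, G.Anc q r → G.Anc r q := by
  -- A node of `T` with the fewest descendants works: a descendant in `T` must have the same
  -- descendants.
  obtain ⟨q, hq, hmin⟩ := Set.exists_min_image T (fun q => {r | G.Anc q r}.ncard) T.toFinite hT
  refine ⟨q, hq, fun r hr hqr => ?_⟩
  have hsub : {s | G.Anc r s} ⊆ {s | G.Anc q s} := fun s hs => hqr.trans hs
  have heq := Set.eq_of_subset_of_ncard_le hsub (hmin r hr) (Set.toFinite _)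
  have hqq : q ∈ {s | G.Anc q s} := Relation.ReflTransGen.refl
  rwa [← heq] at hqq

/-- The global Markov property of simple models: variables that are in different components of the
moralized ancestral graph are conditionally independent. -/
theorem SCM.ci_of_not_conn [StandardBorelSpace Ω] [Finite I] [Fintype J] {M : SCM I J X E}
    (hM : M.IsSimple) {x : ∀ i, Ω → X i} (hx : ∀ i, Measurable (x i)) (h : M.IsSolution μ x)
    {a b : I} {C : Set I} (ha : a ∉ C) (hb : b ∉ C)
    (hab : ¬ M.graph.Conn (M.graph.ancestors a b C) C a b) : CI μ hx {a} {b} C := by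
  obtain ⟨x', e, hx', he, hxx', hindep, hdet⟩ := h.exists_determines hM hx
  refine CI.congr_ae (hx' := hx') hxx' ?_
  set D := M.graph.ancestors a b C with hD
  -- `K` is the moral component of `a`, and `R` collects the exogenous parents of its equations. No
  -- equation in `D` outside `K` has an exogenous parent in `R`.
  let K : Set I := {q | M.graph.Conn D C a q}
  let R : Set J := {j | ∃ q ∈ K, q ∈ D ∧ M.exoPa j q}
  have hstep : ∀ {q q'}, M.graph.Step D C q q' → (q ∈ K ↔ q' ∈ K) := fun hs =>
    ⟨fun hq => Relation.ReflTransGen.tail hq hs, fun hq => Relation.ReflTransGen.tail hq hs.symm⟩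
  -- The induction runs over ancestrally closed sets `T`, peeling off a terminal strongly connected
  -- component. Both groups retain their exogenous variables, from which the peeled component is
  -- recovered.
  have main : ∀ n : ℕ, ∀ T : Set I, T.ncard = n → T ⊆ D →
      (∀ u v, M.graph.dir u v → v ∈ T → u ∈ T) →
      CondIndep (sigmaOf x' (T ∩ C)) (sigmaOf e R ⊔ sigmaOf x' ((T ∩ K) \ C))
        (sigmaOf e Rᶜ ⊔ sigmaOf x' ((T ∩ Kᶜ) \ C)) (sigmaOf_le hx' _) μ := by
    intro n
    induction n using Nat.strong_induction_on with
    | _ n ih =>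
      intro T hn hTD hanc
      rcases T.eq_empty_or_nonempty with rfl | hT
      · have hbot : sigmaOf x' ∅ = ⊥ := by simp [sigmaOf]
        -- With no endogenous variables left, this is independence of the disjoint exogenous
        -- families indexed by `R` and its complement.
        simp only [Set.empty_inter, Set.empty_sdiff, hbot, sup_bot_eq]
        exact condIndep_bot_of_indep (sigmaOf_le he _) (sigmaOf_le he _)
          (indep_iSup_of_disjoint (fun j => (he j).comap_le) hindep disjoint_compl_right)
      obtain ⟨q, hqT, hsink⟩ := M.graph.exists_sink hT
      let Q : Set I := {r | M.graph.SameSCC q r}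
      have hqQ : q ∈ Q := ⟨Relation.ReflTransGen.refl, Relation.ReflTransGen.refl⟩
      have hanc' : ∀ u v, M.graph.Anc u v → v ∈ T → u ∈ T := by
        intro u v huv hv
        induction huv using Relation.ReflTransGen.head_induction_on with
        | refl => exact hv
        | head hd _ ih => exact hanc _ _ hd ih
      have hQT : Q ⊆ T := fun r hr => hanc' r q hr.2 hqT
      have hrec := ih _ (hn ▸ Set.ncard_lt_ncard
        (⟨Set.sdiff_subset, fun hsub => (hsub hqT).2 hqQ⟩ : T \ Q ⊂ T)) (T \ Q) rfl
        (Set.sdiff_subset.trans hTD) fun u v huv hv =>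
          ⟨hanc u v huv hv.1, fun hu => hv.2
            ⟨hu.1.tail huv, hsink v hv.1 (hu.1.tail huv)⟩⟩
      have hQK : ∀ i ∈ Q, (q ∈ K ↔ i ∈ K) :=
        fun i hi => hstep ⟨hTD hqT, hTD (hQT hi), Or.inl hi⟩
      have hpa : ∀ i ∈ Q, ∀ k ∉ Q, M.pa k i → k ∈ T ∧ (k ∈ C ∨ (k ∈ K ↔ q ∈ K)) := by
        intro i hi k hk hki
        have hdir : M.graph.dir k i := ⟨fun h => hk (h ▸ hi), hki⟩
        have hkT := hanc k i hdir (hQT hi)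
        refine ⟨hkT, or_iff_not_imp_left.2 fun hkC => ?_⟩
        exact (hstep ⟨hTD hkT, hTD (hQT hi), Or.inr (Or.inr (Or.inl ⟨hdir, hkC⟩))⟩).trans
          (hQK i hi).symm
      have hexo : ∀ i ∈ Q, ∀ j, M.exoPa j i → (j ∈ R ↔ q ∈ K) := by
        intro i hi j hji
        constructor
        · rintro ⟨p, hpK, hpD, hjp⟩
          rw [hQK i hi]
          by_cases hpi : p = i
          · exact hpi ▸ hpK
          · exact (hstep ⟨hpD, hTD (hQT hi), Or.inr (Or.inl ⟨hpi, j, hjp, hji⟩)⟩).1 hpK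
        · exact fun hq => ⟨i, (hQK i hi).1 hq, hTD (hQT hi), hji⟩
      -- The terminal component lies entirely on one side, as do its exogenous parents and its
      -- unconditioned outside parents; the two sides are symmetric.
      by_cases hqK : q ∈ K
      · exact hdet.condIndep_of_diff (P := K) (P' := Kᶜ) (Q := Q) hx' he (fun i hi hiK => hiK ((hQK i hi).1 hqK))
          (fun i hi k hk hki => (hpa i hi k hk hki).imp_right
            (Or.imp_right fun h => h.2 hqK))
          (fun i hi j hji => (hexo i hi j hji).2 hqK) hrec
      · exact (hdet.condIndep_of_diff (P := Kᶜ) (P' := K) (Q := Q) (R := Rᶜ) (R' := R) hx' he (fun i hi hiK => hqK ((hQK i hi).2 hiK))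
          (fun i hi k hk hki => (hpa i hi k hk hki).imp_right
            (Or.imp_right fun h hk => hqK (h.1 hk)))
          (fun i hi j hji hj => hqK ((hexo i hi j hji).1 hj)) hrec.symm).symm
  have hCD : D ∩ C = C :=
    Set.inter_eq_right.2 fun c hc => Or.inl (DMG.AncSet.of_mem hc)
  have hfin := main _ D rfl subset_rfl fun u v huv hv =>
    DMG.mem_ancestors_of_anc (Relation.ReflTransGen.single huv) hv
  simp only [hCD] at hfin
  refine condIndep_of_condIndep_of_le_left (condIndep_of_condIndep_of_le_right hfin ?_) ?_
  · refine le_sup_of_le_right (sigmaOf_mono x' ?_)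
    rintro _ rfl
    exact ⟨⟨DMG.mem_ancestors_right _ _ _ _, hab⟩, hb⟩
  · refine le_sup_of_le_right (sigmaOf_mono x' ?_)
    rintro _ rfl
    exact ⟨⟨DMG.mem_ancestors_left _ _ _ _, Relation.ReflTransGen.refl⟩, ha⟩

end Markov

/-! ### From observational independences to the graph -/

theorem proposition5 {I J : Type*} [Finite I] [Fintype J]
    {Val : I → Type*} {Exo : J → Type*}
    [∀ i, MeasurableSpace (Val i)] [∀ i, StandardBorelSpace (Val i)]
    [∀ j, MeasurableSpace (Exo j)] [∀ j, StandardBorelSpace (Exo j)]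
    (M : SCM I J Val Exo) (hM : M.IsSimple)
    {Ω : Type*} [MeasurableSpace Ω] [StandardBorelSpace Ω]
    (μ : Measure Ω) [IsProbabilityMeasure μ]
    (ξ : ∀ i, Ω → Val i) (hξ : ∀ i, Measurable (ξ i)) (hsol : M.IsSolution μ ξ)
    (hfaith : SigmaFaithful μ hξ M.graph)
    (V W X Y : I) (S : Set I)
    (hVW : V ≠ W) (hVX : V ≠ X) (hVY : V ≠ Y) (hWX : W ≠ X) (hWY : W ≠ Y) (hXY : X ≠ Y)
    (hVS : V ∉ S) (hWS : W ∉ S) (hXS : X ∉ S) (hYS : Y ∉ S)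
    (hindep : MinIndep μ hξ V Y S {X})
    (hdep : MinDep μ hξ V W S {X}) :
    M.graph.Anc X Y ∧ ¬ M.graph.Anc Y X ∧ ¬ M.graph.AncSet X S ∧
      ¬ M.graph.bi X Y ∧ ¬ M.graph.Confounded (S ∪ {X, Y}) X Y := by
  have hconn : ∀ {a b : I} {C : Set I}, a ∉ C → b ∉ C → ¬ CI μ hξ {a} {b} C →
      M.graph.Conn (M.graph.ancestors a b C) C a b := fun ha hb hCI =>
    by_contra fun h => hCI (SCM.ci_of_not_conn hM hξ hsol ha hb h)
  have hsep : ∀ {a b : I} {C : Set I}, a ≠ b → a ∉ C → b ∉ C → CI μ hξ {a} {b} C →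
      ¬ M.graph.Conn (M.graph.ancestors a b C) C a b := fun hab ha hb hCI =>
    (hfaith _ _ _ (Set.disjoint_singleton.2 hab) (Set.disjoint_singleton_left.2 ha)
      (Set.disjoint_singleton_left.2 hb) hCI).not_conn ha hb
  -- The empty set is the only proper subset of `{X}`, so minimality is exactly the pair of
  -- statements given `S` alone.
  have hempty : (∅ : Set I) ⊂ {X} := Set.empty_ssubset.2 (Set.singleton_nonempty X)
  have hi := hindep.2 ∅ hempty
  have hd := hdep.2 ∅ hempty
  rw [Set.union_empty] at hi hd
  have hVSX : V ∉ S ∪ {X} := fun h => h.elim hVS hVX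
  exact DMG.unconfounded_ancestor_of_conn (hconn hVS hYS hi)
    (hsep hVY hVSX (fun h => h.elim hYS hXY.symm) hindep.1)
    (hconn hVSX (fun h => h.elim hWS hWX) hdep.1) (hsep hVW hVS hWS hd)
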